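/- Let $d\in\mathbb{N}$. A congruence on $\mathbb{N}^d$ is an equivalence relation $\mathcal{Q}\subseteq\mathbb{N}^d\times\mathbb{N}^d$ such that $(a,b)\in\mathcal{Q}$ implies $(a+c,b+c)\in\mathcal{Q}$ for all $c\in\mathbb{N}^d$; it is also regarded as a subset of $\mathbb{N}^{2d}$. Order vectors componentwise, write $\|\cdot\|$ for the maximum norm and $X{\uparrow}=\{y\mid \exists x\in X\colon x\le y\}$ for the upward closure. For a congruence $\mathcal{Q}$ on $\mathbb{N}^d$ put \[U(\mathcal{Q})=\{(x,y,u,v)\mid (x,y)\in\mathcal{Q},\ (x+u,y+v)\in\mathcal{Q},\ (u,v)\neq(0,0)\}{\uparrow}\subseteq\mathbb{N}^{4d}.\] (1) For every congruence $\mathcal{Q}$ on $\mathbb{N}^d$, the set $U(\mathcal{Q})$ is upward closed. (2) If $\mathcal{Q}_1\subseteq\mathcal{Q}_2$ are congruences on $\mathbb{N}^d$, then $U(\mathcal{Q}_1)\subseteq U(\mathcal{Q}_2)$, and for each $q\in\mathcal{Q}_2\setminus\mathcal{Q}_1$ there is $p\in U(\mathcal{Q}_2)\setminus U(\mathcal{Q}_1)$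 with $\|p\|\le\|q\|$. (3) Let $g\colon\mathbb{N}\to\mathbb{N}$ be monotone, strictly inflationary ($g(x)>x$ for all $x$) and super-homogeneous ($g(xy)\ge g(x)\cdot y$ for all $x,y\ge1$), and let $n\in\mathbb{N}$. Let $\mathcal{Q}_0\subsetneq\mathcal{Q}_1\subsetneq\dots\subsetneq\mathcal{Q}_\ell$ be a chain of congruences on $\mathbb{N}^d$ that is $(g,n)$-controlled, i.e. for each $0\le i<\ell$ there is $s_i\in\mathcal{Q}_{i+1}\setminus\mathcal{Q}_i$ with $\|s_i\|\le g^i(n)$, where $g^i$ is the $i$-fold iterate. Then its length (the number $\ell+1$ of its members) satisfies \[\ell+1\le 1+g^{\omega^{4d}}(4dn).\] Here $(g^\alpha)_\alpha$ is the Hardy hierarchy relative to $g$: $g^0(x)=x$, $g^{\alpha+1}(x)=g^\alpha(g(x))$, and $g^\lambda(x)=g^{\lambda(x)}(x)$ for limit $\lambda$, with the fundamental sequences $(\beta+\omega^{k+1})(x)=\beta+\omega^k\cdot(x+1)$, where $\beta+\omega^{k+1}$ is in Cantor normal form. -/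

import Mathlib

namespace CongChain

/-- The maximum norm of a vector of natural numbers (`0` if there are no coordinates). -/
def maxNorm {ι : Type} [Fintype ι] (x : ι → ℕ) : ℕ := Finset.univ.sup x

/-- `S 0 ⊊ S 1 ⊊ ⋯ ⊊ S ℓ` is a `(g, n)`-controlled chain of sets of vectors. It consists of
`ℓ + 1` sets. -/
structure IsControlledChain (g : ℕ → ℕ) (n : ℕ) {ι : Type} [Fintype ι] {ℓ : ℕ}
    (S : Fin (ℓ + 1) → Set (ι → ℕ)) : Prop where
  /-- Consecutive members are strictly increasing. -/
  ssubset : ∀ i : Fin ℓ, S i.castSucc ⊂ S i.succ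
  /-- The `i`-th strict inclusion has a witness of norm at most `g^i(n)`. -/
  control : ∀ i : Fin ℓ, ∃ s ∈ S i.succ \ S i.castSucc, maxNorm s ≤ g^[(i : ℕ)] n

/-- A congruence on `ℕ^d` as a set of vectors in `ℕ^{2d}`; the vector `(x, y)` is
`Sum.elim x y`. -/
def graph {d : ℕ} (Q : AddCon (Fin d → ℕ)) : Set (Fin d ⊕ Fin d → ℕ) :=
  {p | Q (p ∘ Sum.inl) (p ∘ Sum.inr)}

/-- The subset `U(Q)` of `ℕ^{4d}`: the upward closure of the set of all `(x, y, u, v)` with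
`(x, y) ∈ Q`, `(x + u, y + v) ∈ Q` and `(u, v) ≠ (0, 0)`. -/
def translation {d : ℕ} (Q : AddCon (Fin d → ℕ)) :
    Set ((Fin d ⊕ Fin d) ⊕ (Fin d ⊕ Fin d) → ℕ) :=
  ↑(upperClosure {w : (Fin d ⊕ Fin d) ⊕ (Fin d ⊕ Fin d) → ℕ |
    ∃ x y u v : Fin d → ℕ, w = Sum.elim (Sum.elim x y) (Sum.elim u v) ∧
      Q x y ∧ Q (x + u) (y + v) ∧ (u, v) ≠ (0, 0)})

/-- The Hardy hierarchy relative to `h`, indexed by ordinal notations in Cantor normal form: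
`h^0(x) = x`, `h^{α+1}(x) = h^α(h(x))` and `h^λ(x) = h^{λ(x)}(x)`. For a limit `λ` the sequence
`λ(x)` is Mathlib's fundamental sequence, which has
`(β + ω^{k+1})(x) = β + ω^k * (x + 1)` and `ω^ω(x) = ω^{x+1}`. -/
def hardy (h : ℕ → ℕ) : ONote → ℕ → ℕ
  | o =>
    match ONote.fundamentalSequence o, ONote.fundamentalSequence_has_prop o with
    | Sum.inl none, _ => id
    | Sum.inl (some a), hp =>
      have : a < o := by rw [ONote.lt_def, hp.1]; apply Order.lt_succ
      fun x => hardy h a (h x)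
    | Sum.inr f, hp => fun x =>
      have : f x < o := (hp.2.1 x).2.1
      hardy h (f x) x
  termination_by o => o

/-- The ordinal notation of `ω^k`. -/
def omegaPow (k : ℕ) : ONote := ONote.oadd (ONote.ofNat k) 1 0

theorem omegaPow_NF (k : ℕ) : (omegaPow k).NF := by
  unfold omegaPow; infer_instance

theorem omegaPow_repr (k : ℕ) : (omegaPow k).repr = Ordinal.omega0 ^ k := by
  simp [omegaPow]

theorem hardy_def (h : ℕ → ℕ) {o : ONote} {s : Option ONote ⊕ (ℕ → ONote)}
    (e : ONote.fundamentalSequence o = s) :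
    hardy h o =
      match (motive := (x : Option ONote ⊕ (ℕ → ONote)) → ONote.FundamentalSequenceProp o x →
        ℕ → ℕ) s, e ▸ ONote.fundamentalSequence_has_prop o with
      | Sum.inl none, _ => id
      | Sum.inl (some a), _ => fun x => hardy h a (h x)
      | Sum.inr f, _ => fun x => hardy h (f x) x := by
  subst s
  rw [hardy]

theorem hardy_zero (h : ℕ → ℕ) {o : ONote}
    (e : ONote.fundamentalSequence o = Sum.inl none) (x : ℕ) : hardy h o x = x := by
  rw [hardy_def h e]; rfl

theorem hardy_succ (h : ℕ → ℕ) {o a : ONote}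
    (e : ONote.fundamentalSequence o = Sum.inl (some a)) (x : ℕ) :
    hardy h o x = hardy h a (h x) := by
  rw [hardy_def h e]

theorem hardy_limit (h : ℕ → ℕ) {o : ONote} {f : ℕ → ONote}
    (e : ONote.fundamentalSequence o = Sum.inr f) (x : ℕ) :
    hardy h o x = hardy h (f x) x := by
  rw [hardy_def h e]

end CongChain

/-! Each new pair `q` splits as `z + w` with `z` a maximal pair of the old congruence below `q`;
then `(z, w)` lies in the new `translation` but not the old one (`exists_mem_translation_diff`). So
the chain yields a controlled bad sequence in dimension `D = 4 * d`. Its length is bounded in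
`bad_sequence_length_le`. The points not above any earlier term are covered by finitely many slices,
and a slice with `k` free coordinates weighs `ω^k`. The next term lies in some slice and splits it
into at most `D * maxNorm p` slices of one dimension less. By `potential_step`, the Hardy function
of the total weight, evaluated at `g^i(D * n)`, never increases. It starts at `g^{ω^D}(D * n)` and
after `ℓ` steps is still at least `ℓ`. -/

namespace CongChain

/-! ### The functions `g^{ω^k}` by iteration -/

/-- `hardyPow g k` is the function `g^{ω^k}`, defined by iteration. -/
def hardyPow (g : ℕ → ℕ) : ℕ → ℕ → ℕ
  | 0 => g
  | k + 1 => fun x => (hardyPow g k)^[x + 1] x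

section Hardy

open ONote

theorem fundamentalSequence_ofNat_succ (k : ℕ) :
    fundamentalSequence (ofNat (k + 1)) = Sum.inl (some (ofNat k)) := by
  cases k <;> rfl

/-- As long as the tail `b` is nonzero, fundamental sequences act on `b` alone, so the tail is used
up before the leading term is touched. -/
theorem hardy_oadd (h : ℕ → ℕ) (a : ONote) (m : ℕ+) (b : ONote) (x : ℕ) :
    hardy h (oadd a m b) x = hardy h (oadd a m 0) (hardy h b x) := by
  induction b using (InvImage.wf ONote.repr Ordinal.lt_wf).induction generalizing x with
  | _ b ih =>
    have hp := fundamentalSequence_has_prop b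
    rcases e : fundamentalSequence b with (_ | b') | f <;> rw [e] at hp
    · obtain rfl : b = 0 := hp
      rw [hardy_zero h (o := 0) rfl]
    · have hlt : b' < b := by rw [lt_def, hp.1]; apply Order.lt_succ
      rw [hardy_succ h e, ← ih b' hlt,
        hardy_succ h (o := oadd a m b) (a := oadd a m b') (by simp [fundamentalSequence, e])]
    · rw [hardy_limit h e, ← ih (f x) (hp.2.1 x).2.1,
        hardy_limit h (o := oadd a m b) (f := fun i => oadd a m (f i))
          (by simp [fundamentalSequence, e])]

theorem hardy_oadd_ofNat (h : ℕ → ℕ) (k m : ℕ) (x : ℕ) :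
    hardy h (oadd (ofNat k) m.succPNat 0) x = (hardyPow h k)^[m + 1] x := by
  induction k generalizing m x with
  | zero =>
    induction m generalizing x with
    | zero =>
      rw [hardy_succ h (a := 0) rfl, hardy_zero h rfl]
      rfl
    | succ m ih =>
      rw [hardy_succ h (a := oadd (ofNat 0) m.succPNat 0) rfl, ih]
      rfl
  | succ k ihk =>
    induction m generalizing x with
    | zero =>
      rw [hardy_limit h (f := fun i => oadd (ofNat k) i.succPNat 0)
        (by rw [fundamentalSequence, fundamentalSequence_ofNat_succ]; rfl), ihk]
      rfl
    | succ m ihm =>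
      rw [hardy_limit h
        (f := fun i => oadd (ofNat (k + 1)) m.succPNat (oadd (ofNat k) i.succPNat 0))
        (by rw [fundamentalSequence, fundamentalSequence_ofNat_succ]; rfl), hardy_oadd, ihm, ihk]
      rfl

theorem hardy_omegaPow (h : ℕ → ℕ) (k : ℕ) : hardy h (omegaPow k) = hardyPow h k :=
  funext fun x => hardy_oadd_ofNat h k 0 x

end Hardy

/-! ### Hardy functions of ordinals below `ω^ω` as potentials -/

section Potential

variable {g : ℕ → ℕ}

theorem le_hardyPow (hinf : ∀ x, x < g x) (k : ℕ) : id ≤ hardyPow g k := by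
  induction k with
  | zero => exact fun x => (hinf x).le
  | succ k ih => exact fun x => Function.id_le_iterate_of_id_le ih (x + 1) x

theorem monotone_hardyPow (hg : Monotone g) (hinf : ∀ x, x < g x) (k : ℕ) :
    Monotone (hardyPow g k) := by
  induction k with
  | zero => exact hg
  | succ k ih =>
    intro x y hxy
    exact (ih.iterate _ hxy).trans
      (Function.monotone_iterate_of_id_le (le_hardyPow hinf k) (by omega) y)

theorem hardyPow_le_succ (hinf : ∀ x, x < g x) (k x : ℕ) :
    hardyPow g k x ≤ hardyPow g (k + 1) x :=
  Function.monotone_iterate_of_id_le (le_hardyPow hinf k) (show 1 ≤ x + 1 by omega) x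

/-- `potential g c N` is the function `g^α` for `α = ω^(N-1) * c (N-1) + ⋯ + ω^0 * c 0`. -/
def potential (g : ℕ → ℕ) (c : ℕ → ℕ) : ℕ → ℕ → ℕ
  | 0, x => x
  | N + 1, x => (hardyPow g N)^[c N] (potential g c N x)

theorem le_potential (hinf : ∀ x, x < g x) (c : ℕ → ℕ) (N x : ℕ) : x ≤ potential g c N x := by
  induction N with
  | zero => exact le_rfl
  | succ N ih => exact ih.trans (Function.id_le_iterate_of_id_le (le_hardyPow hinf N) _ _)

theorem potential_le_of_le (hg : Monotone g) (hinf : ∀ x, x < g x) {c c' : ℕ → ℕ} {M x y : ℕ}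
    (h : potential g c' M y ≤ potential g c M x) {N : ℕ} (hc : ∀ j, M ≤ j → j < N → c' j ≤ c j)
    (hN : M ≤ N) : potential g c' N y ≤ potential g c N x := by
  induction N, hN using Nat.le_induction with
  | base => exact h
  | succ N hN ih =>
    exact ((monotone_hardyPow hg hinf N).iterate _
      (ih fun j h₁ h₂ => hc j h₁ (h₂.trans N.lt_succ_self))).trans
      (Function.monotone_iterate_of_id_le (le_hardyPow hinf N) (hc N hN N.lt_succ_self) _)

theorem potential_eq_self {c : ℕ → ℕ} {N : ℕ} (hc : ∀ j < N, c j = 0) (x : ℕ) :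
    potential g c N x = x := by
  induction N with
  | zero => rfl
  | succ N ih =>
    rw [potential, hc N N.lt_succ_self, ih fun j hj => hc j (hj.trans N.lt_succ_self)]
    rfl

/-- The inner `g` moves outward one level at a time: `hardyPow g N` commutes with its own iterates
and is dominated by the next level. -/
theorem potential_apply_le (hg : Monotone g) (hinf : ∀ x, x < g x) (c : ℕ → ℕ) (N x : ℕ) :
    potential g c N (g x) ≤ hardyPow g N (potential g c N x) := by
  induction N with
  | zero => exact le_rfl
  | succ N ih =>
    calc (hardyPow g N)^[c N] (potential g c N (g x))
        ≤ (hardyPow g N)^[c N] (hardyPow g N (potential g c N x)) :=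
          (monotone_hardyPow hg hinf N).iterate _ ih
      _ = hardyPow g N ((hardyPow g N)^[c N] (potential g c N x)) := by
          rw [← Function.iterate_succ_apply, Function.iterate_succ_apply']
      _ ≤ _ := hardyPow_le_succ hinf N _

/-- Replacing one summand `ω^k` by at most `x` summands `ω^(k-1)` while passing from `x` to `g x`
does not increase the potential. -/
theorem potential_step (hg : Monotone g) (hinf : ∀ x, x < g x) {c c' : ℕ → ℕ} {k x N : ℕ}
    (hk : c' k + 1 ≤ c k) (hpred : ∀ j, j + 1 = k → c' j ≤ c j + x)
    (hne : ∀ j, j ≠ k → j + 1 ≠ k → c' j ≤ c j) (hkN : k < N) :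
    potential g c' N (g x) ≤ potential g c N x := by
  refine potential_le_of_le hg hinf (M := k + 1) ?_
    (fun j h₁ _ => hne j (by omega) (by omega)) hkN
  cases k with
  | zero =>
    change g^[c' 0] (g x) ≤ g^[c 0] x
    rw [← Function.iterate_succ_apply]
    exact Function.monotone_iterate_of_id_le (fun x => (hinf x).le) hk x
  | succ m =>
    set F := hardyPow g m with hF
    have hmono : Monotone F := monotone_hardyPow hg hinf m
    have hid : id ≤ F := le_hardyPow hinf m
    have hlow : potential g c' m (g x) ≤ F (potential g c m x) :=
      (potential_le_of_le hg hinf (c := c) (c' := c') (M := 0) (x := g x) (y := g x) le_rfl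
        (fun j _ h₂ => hne j (by omega) (by omega)) (Nat.zero_le m)).trans
        (potential_apply_le hg hinf c m x)
    set z := potential g c m x with hz
    set y := F^[c m] z with hy
    have hxy : x ≤ y :=
      (le_potential hinf c m x).trans (Function.id_le_iterate_of_id_le hid _ _)
    -- The removed `ω^(m+1)` supplies `y + 1` iterations of `F`. As `x ≤ y`, these pay for the `x`
    -- new summands and for the one `F` that absorbs the inner `g`.
    have key : F^[c' m] (potential g c' m (g x)) ≤ hardyPow g (m + 1) y :=
      calc F^[c' m] (potential g c' m (g x)) ≤ F^[c' m] (F z) := hmono.iterate _ hlow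
        _ = F^[c' m + 1] z := (Function.iterate_succ_apply F _ z).symm
        _ ≤ F^[(y + 1) + c m] z := Function.monotone_iterate_of_id_le hid
            (by have := hpred m rfl; omega) z
        _ = F^[y + 1] y := Function.iterate_add_apply F _ _ z
    calc (hardyPow g (m + 1))^[c' (m + 1)] (F^[c' m] (potential g c' m (g x)))
        ≤ (hardyPow g (m + 1))^[c' (m + 1)] (hardyPow g (m + 1) y) :=
          (monotone_hardyPow hg hinf _).iterate _ key
      _ = (hardyPow g (m + 1))^[c' (m + 1) + 1] y := (Function.iterate_succ_apply _ _ _).symm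
      _ ≤ (hardyPow g (m + 1))^[c (m + 1)] y :=
          Function.monotone_iterate_of_id_le (le_hardyPow hinf _) hk y

end Potential

/-! ### Slices of `ℕ^ι` -/

section Slice

variable {ι : Type} [Fintype ι]

/-- The number of free coordinates of the slice of `ℕ^ι` described by `σ`. -/
def sliceDim (σ : ι → Option ℕ) : ℕ := (Finset.univ.filter fun j => σ j = none).card

/-- The point `p` lies in the slice obtained by fixing the coordinates prescribed by `σ`. -/
def MemSlice (σ : ι → Option ℕ) (p : ι → ℕ) : Prop := ∀ j, ∀ a ∈ σ j, p j = a

theorem sliceDim_le (σ : ι → Option ℕ) : sliceDim σ ≤ Fintype.card ι :=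
  Finset.card_le_univ _

/-- The number of members of `𝒮` with exactly `k` free coordinates. -/
def sliceCount (𝒮 : Finset (ι → Option ℕ)) (k : ℕ) : ℕ :=
  (𝒮.filter fun σ => sliceDim σ = k).card

theorem sliceCount_union_le (𝒮 𝒯 : Finset (ι → Option ℕ)) (k : ℕ) :
    sliceCount (𝒮 ∪ 𝒯) k ≤ sliceCount 𝒮 k + sliceCount 𝒯 k := by
  rw [sliceCount, Finset.filter_union]
  exact Finset.card_union_le _ _

variable [DecidableEq ι]

/-- Slices covering the points of the slice `σ` that are not above its point `p`. -/
def cutSlices (σ : ι → Option ℕ) (p : ι → ℕ) : Finset (ι → Option ℕ) :=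
  (Finset.univ.filter fun j => σ j = none).biUnion fun j =>
    (Finset.range (p j)).image fun a => Function.update σ j (some a)

theorem mem_cutSlices {σ τ : ι → Option ℕ} {p : ι → ℕ} :
    τ ∈ cutSlices σ p ↔ ∃ j, σ j = none ∧ ∃ a < p j, Function.update σ j (some a) = τ := by
  simp [cutSlices]

theorem card_cutSlices_le (σ : ι → Option ℕ) (p : ι → ℕ) :
    (cutSlices σ p).card ≤ Fintype.card ι * maxNorm p :=
  calc (cutSlices σ p).card
      ≤ sliceDim σ * maxNorm p := by
        refine Finset.card_biUnion_le_card_mul _ _ _ fun j _ => Finset.card_image_le.trans ?_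
        rw [Finset.card_range]
        exact Finset.le_sup (f := p) (Finset.mem_univ j)
    _ ≤ _ := Nat.mul_le_mul_right _ (sliceDim_le σ)

theorem sliceDim_of_mem_cutSlices {σ τ : ι → Option ℕ} {p : ι → ℕ} (h : τ ∈ cutSlices σ p) :
    sliceDim τ + 1 = sliceDim σ := by
  obtain ⟨j, hj, a, -, rfl⟩ := mem_cutSlices.1 h
  have : (Finset.univ.filter fun i => Function.update σ j (some a) i = none) =
      (Finset.univ.filter fun i => σ i = none).erase j := by
    ext i
    by_cases hi : i = j
    · subst hi; simp
    · simp [hi]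
  rw [sliceDim, this, sliceDim, Finset.card_erase_add_one (by simpa using hj)]

/-- A coordinate with `q j < p j` must be free, since `p` and `q` agree on the fixed ones; fixing it
at `q j` gives the slice. -/
theorem exists_mem_cutSlices {σ : ι → Option ℕ} {p q : ι → ℕ} (hp : MemSlice σ p)
    (hq : MemSlice σ q) (hpq : ¬ p ≤ q) : ∃ τ ∈ cutSlices σ p, MemSlice τ q := by
  obtain ⟨j, hj⟩ : ∃ j, q j < p j := by simpa [Pi.le_def] using hpq
  have hσ : σ j = none := by
    rw [Option.eq_none_iff_forall_not_mem]
    intro a ha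
    rw [hp j a ha, hq j a ha] at hj
    exact hj.false
  refine ⟨Function.update σ j (some (q j)), mem_cutSlices.2 ⟨j, hσ, q j, hj, rfl⟩, ?_⟩
  intro i a ha
  by_cases hi : i = j
  · subst hi; simpa using ha
  · rw [Function.update_of_ne hi] at ha
    exact hq i a ha

theorem sliceCount_cutSlices_of_ne {σ : ι → Option ℕ} {p : ι → ℕ} {k : ℕ}
    (hk : k + 1 ≠ sliceDim σ) : sliceCount (cutSlices σ p) k = 0 := by
  rw [sliceCount, Finset.card_eq_zero, Finset.filter_eq_empty_iff]
  intro τ hτ h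
  exact hk (h ▸ sliceDim_of_mem_cutSlices hτ)

theorem potential_replace_slice {g : ℕ → ℕ} (hg : Monotone g) (hinf : ∀ x, x < g x)
    {𝒮 : Finset (ι → Option ℕ)} {σ : ι → Option ℕ} (hσ : σ ∈ 𝒮) {p : ι → ℕ} {x : ℕ}
    (hx : Fintype.card ι * maxNorm p ≤ x) :
    potential g (sliceCount (𝒮.erase σ ∪ cutSlices σ p)) (Fintype.card ι + 1) (g x) ≤
      potential g (sliceCount 𝒮) (Fintype.card ι + 1) x := by
  have herase : ∀ k, sliceCount (𝒮.erase σ) k ≤ sliceCount 𝒮 k := fun k =>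
    Finset.card_le_card (Finset.filter_subset_filter _ (Finset.erase_subset _ _))
  refine potential_step hg hinf (k := sliceDim σ) ?_ ?_ ?_ (Nat.lt_succ_of_le (sliceDim_le σ))
  · have h₁ := sliceCount_union_le (𝒮.erase σ) (cutSlices σ p) (sliceDim σ)
    rw [sliceCount_cutSlices_of_ne (by omega)] at h₁
    have h₂ : sliceCount (𝒮.erase σ) (sliceDim σ) + 1 = sliceCount 𝒮 (sliceDim σ) := by
      rw [sliceCount, Finset.filter_erase, Finset.card_erase_add_one (by simp [hσ]), sliceCount]
    omega
  · intro j _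
    have h₁ := sliceCount_union_le (𝒮.erase σ) (cutSlices σ p) j
    have h₂ : sliceCount (cutSlices σ p) j ≤ x :=
      (Finset.card_filter_le _ _).trans ((card_cutSlices_le σ p).trans hx)
    have := herase j
    omega
  · intro j _ hj
    have h₁ := sliceCount_union_le (𝒮.erase σ) (cutSlices σ p) j
    rw [sliceCount_cutSlices_of_ne hj] at h₁
    exact h₁.trans (herase j)

/-- Moves the dimension factor inside the iterate, so that the number of new slices is bounded by
the current argument of the potential. -/
theorem mul_iterate_le {g : ℕ → ℕ} (hg : Monotone g) (hinf : ∀ x, x < g x)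
    (hsup : ∀ x y, 1 ≤ x → 1 ≤ y → g x * y ≤ g (x * y)) (D : ℕ) {n : ℕ} (hn : 1 ≤ n) (i : ℕ) :
    D * g^[i] n ≤ g^[i] (D * n) := by
  rcases Nat.eq_zero_or_pos D with rfl | hD
  · simp
  induction i with
  | zero => exact le_rfl
  | succ i ih =>
    rw [Function.iterate_succ_apply', Function.iterate_succ_apply', mul_comm]
    have hpos : 1 ≤ g^[i] n :=
      hn.trans (Function.id_le_iterate_of_id_le (fun x => (hinf x).le) i n)
    refine (hsup _ D hpos hD).trans (hg ?_)
    rwa [mul_comm]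

/-- The length function theorem for controlled bad sequences over `ℕ^ι`. -/
theorem bad_sequence_length_le {g : ℕ → ℕ} (hg : Monotone g) (hinf : ∀ x, x < g x)
    (hsup : ∀ x y, 1 ≤ x → 1 ≤ y → g x * y ≤ g (x * y)) {n ℓ : ℕ} (hn : 1 ≤ n)
    (p : Fin ℓ → ι → ℕ) (hctrl : ∀ i : Fin ℓ, maxNorm (p i) ≤ g^[(i : ℕ)] n)
    (hbad : ∀ i j : Fin ℓ, i < j → ¬ p i ≤ p j) :
    ℓ ≤ hardyPow g (Fintype.card ι) (Fintype.card ι * n) := by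
  set D := Fintype.card ι with hD
  have key : ∀ i ≤ ℓ, ∃ 𝒮 : Finset (ι → Option ℕ),
      (∀ q : ι → ℕ, (∀ j : Fin ℓ, (j : ℕ) < i → ¬ p j ≤ q) → ∃ σ ∈ 𝒮, MemSlice σ q) ∧
      potential g (sliceCount 𝒮) (D + 1) (g^[i] (D * n)) ≤ hardyPow g D (D * n) := by
    intro i
    induction i with
    | zero =>
      intro _
      refine ⟨{fun _ => none}, fun q _ => ⟨_, Finset.mem_singleton_self _, by simp [MemSlice]⟩, ?_⟩
      have hdim : sliceDim (fun _ : ι => (none : Option ℕ)) = D := by simp [sliceDim, hD]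
      have h₀ : ∀ j < D, sliceCount {fun _ : ι => (none : Option ℕ)} j = 0 := fun j hj => by
        simp [sliceCount, Finset.filter_singleton, hdim, hj.ne']
      have h₁ : sliceCount {fun _ : ι => (none : Option ℕ)} D = 1 := by
        simp [sliceCount, Finset.filter_singleton, hdim]
      rw [potential, potential_eq_self h₀, h₁]
      exact le_rfl
    | succ i ih =>
      intro hi
      obtain ⟨𝒮, hcov, hpot⟩ := ih (by omega)
      -- Badness says exactly that the next term is among the covered points.
      obtain ⟨σ, hσ, hpσ⟩ := hcov (p ⟨i, hi⟩) fun j hj => hbad _ _ hj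
      refine ⟨𝒮.erase σ ∪ cutSlices σ (p ⟨i, hi⟩), fun q hq => ?_, ?_⟩
      · obtain ⟨τ, hτ, hqτ⟩ := hcov q fun j hj => hq j (by omega)
        by_cases h : τ = σ
        · subst h
          obtain ⟨ρ, hρ, hqρ⟩ := exists_mem_cutSlices hpσ hqτ (hq ⟨i, hi⟩ (Nat.lt_succ_self i))
          exact ⟨ρ, Finset.mem_union_right _ hρ, hqρ⟩
        · exact ⟨τ, Finset.mem_union_left _ (Finset.mem_erase.2 ⟨h, hτ⟩), hqτ⟩
      · rw [Function.iterate_succ_apply']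
        exact (potential_replace_slice hg hinf hσ
          ((Nat.mul_le_mul_left _ (hctrl ⟨i, hi⟩)).trans
            (mul_iterate_le hg hinf hsup D hn i))).trans hpot
  obtain ⟨𝒮, -, hpot⟩ := key ℓ le_rfl
  have hiter : ∀ i, i ≤ g^[i] (D * n) := by
    intro i
    induction i with
    | zero => exact Nat.zero_le _
    | succ i ih =>
      rw [Function.iterate_succ_apply']
      exact Nat.succ_le_of_lt (ih.trans_lt (hinf _))
  exact (hiter ℓ).trans ((le_potential hinf _ _ _).trans hpot)

end Slice

/-! ### The upward closed set of a congruence -/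

theorem mem_translation {d : ℕ} {Q : AddCon (Fin d → ℕ)}
    {w : (Fin d ⊕ Fin d) ⊕ (Fin d ⊕ Fin d) → ℕ} :
    w ∈ translation Q ↔ ∃ x y u v : Fin d → ℕ,
      Q x y ∧ Q (x + u) (y + v) ∧ (u, v) ≠ (0, 0) ∧
        Sum.elim (Sum.elim x y) (Sum.elim u v) ≤ w := by
  simp only [translation, SetLike.mem_coe, mem_upperClosure, Set.mem_ofPred_eq]
  constructor
  · rintro ⟨_, ⟨x, y, u, v, rfl, h₁, h₂, h₃⟩, hw⟩
    exact ⟨x, y, u, v, h₁, h₂, h₃, hw⟩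
  · rintro ⟨x, y, u, v, h₁, h₂, h₃, hw⟩
    exact ⟨_, ⟨x, y, u, v, rfl, h₁, h₂, h₃⟩, hw⟩

theorem mem_graph_sumElim {d : ℕ} {Q : AddCon (Fin d → ℕ)} {x y : Fin d → ℕ} :
    Sum.elim x y ∈ graph Q ↔ Q x y := Iff.rfl

theorem graph_subset_iff {d : ℕ} {Q₁ Q₂ : AddCon (Fin d → ℕ)} :
    graph Q₁ ⊆ graph Q₂ ↔ Q₁ ≤ Q₂ :=
  ⟨fun h _ _ hxy => mem_graph_sumElim.1 (h (mem_graph_sumElim.2 hxy)), fun h _ hp => h hp⟩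

theorem translation_mono {d : ℕ} {Q₁ Q₂ : AddCon (Fin d → ℕ)} (h : Q₁ ≤ Q₂) :
    translation Q₁ ⊆ translation Q₂ := by
  intro w hw
  obtain ⟨x, y, u, v, h₁, h₂, h₃⟩ := mem_translation.1 hw
  exact mem_translation.2 ⟨x, y, u, v, h h₁, h h₂, h₃⟩

/-- A translation witness below `(x, y, u, v)` can be applied at the pair `(x, y)` itself. -/
theorem exists_add_of_mem_translation {d : ℕ} {Q : AddCon (Fin d → ℕ)} {x y u v : Fin d → ℕ}
    (hxy : Q x y) (hw : Sum.elim (Sum.elim x y) (Sum.elim u v) ∈ translation Q) :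
    ∃ u' ≤ u, ∃ v' ≤ v, (u', v') ≠ (0, 0) ∧ Q (x + u') (y + v') := by
  obtain ⟨x', y', u', v', h₁, h₂, h₃, hle⟩ := mem_translation.1 hw
  obtain ⟨⟨hx, hy⟩, hu, hv⟩ : (x' ≤ x ∧ y' ≤ y) ∧ u' ≤ u ∧ v' ≤ v := by
    simpa only [Sum.elim_le_elim_iff] using hle
  refine ⟨u', hu, v', hv, h₃, ?_⟩
  obtain ⟨c, rfl⟩ := exists_add_of_le hx
  obtain ⟨e, rfl⟩ := exists_add_of_le hy
  have h₄ : Q (x' + u' + c) (y' + v' + c) := Q.add h₂ (Q.refl c)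
  -- Both sides are congruent to `x' + c`; this trades the shift `c` for `e` in the second
  -- component.
  have h₅ : Q (y' + c) (y' + e) := Q.trans (Q.add (Q.symm h₁) (Q.refl c)) hxy
  have h₆ : Q (y' + c + v') (y' + e + v') := Q.add h₅ (Q.refl v')
  rw [add_right_comm x', add_right_comm y'] at h₄
  exact Q.trans h₄ h₆

theorem exists_mem_translation_diff {d : ℕ} {Q₁ Q₂ : AddCon (Fin d → ℕ)} (h : Q₁ ≤ Q₂)
    {q : Fin d ⊕ Fin d → ℕ} (hq : q ∈ graph Q₂ \ graph Q₁) :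
    ∃ p ∈ translation Q₂ \ translation Q₁, maxNorm p ≤ maxNorm q := by
  have hfin : {z : Fin d ⊕ Fin d → ℕ | z ∈ graph Q₁ ∧ z ≤ q}.Finite :=
    (Set.finite_Iic q).subset fun z hz => hz.2
  -- If `(z, q - z)` were in `translation Q₁`, then `z` could be enlarged inside `Q₁` while staying
  -- below `q`.
  obtain ⟨z, ⟨hz₁, hzq⟩, hmax⟩ := hfin.exists_maximal ⟨0, Q₁.refl 0, fun _ => Nat.zero_le _⟩
  obtain ⟨w, rfl⟩ := exists_add_of_le hzq
  obtain ⟨x, y, rfl⟩ : ∃ x y : Fin d → ℕ, z = Sum.elim x y :=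
    ⟨_, _, (Sum.elim_comp_inl_inr z).symm⟩
  obtain ⟨u, v, rfl⟩ : ∃ u v : Fin d → ℕ, w = Sum.elim u v :=
    ⟨_, _, (Sum.elim_comp_inl_inr w).symm⟩
  have hadd : ∀ u v : Fin d → ℕ, Sum.elim x y + Sum.elim u v = Sum.elim (x + u) (y + v) :=
    fun u v => by ext (i | i) <;> rfl
  refine ⟨Sum.elim (Sum.elim x y) (Sum.elim u v), ⟨?_, fun hmem => ?_⟩, ?_⟩
  · refine mem_translation.2 ⟨x, y, u, v, h hz₁, ?_, ?_, le_rfl⟩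
    · exact mem_graph_sumElim.1 (hadd u v ▸ hq.1)
    · rintro huv
      obtain ⟨rfl, rfl⟩ := Prod.mk.inj huv
      refine hq.2 ?_
      rw [hadd, add_zero, add_zero]
      exact hz₁
  · obtain ⟨u', hu, v', hv, hne, hQ⟩ := exists_add_of_mem_translation hz₁ hmem
    have hle : Sum.elim (x + u') (y + v') ≤ Sum.elim x y := by
      refine hmax ⟨hQ, ?_⟩ ?_
      · rw [hadd, Sum.elim_le_elim_iff]
        exact ⟨add_le_add_right hu x, add_le_add_right hv y⟩
      · rw [Sum.elim_le_elim_iff]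
        exact ⟨le_self_add, le_self_add⟩
    rw [Sum.elim_le_elim_iff] at hle
    refine hne (Prod.ext (funext fun i => ?_) (funext fun i => ?_))
    · have := hle.1 i
      simp only [Pi.add_apply] at this
      simp only [Pi.zero_apply]
      omega
    · have := hle.2 i
      simp only [Pi.add_apply] at this
      simp only [Pi.zero_apply]
      omega
  · refine Finset.sup_le fun i _ => ?_
    rcases i with i | i
    · exact le_trans (Nat.le_add_right _ _)
        (Finset.le_sup (f := Sum.elim x y + Sum.elim u v) (Finset.mem_univ i))
    · exact le_trans (Nat.le_add_left _ _)
        (Finset.le_sup (f := Sum.elim x y + Sum.elim u v) (Finset.mem_univ i))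

theorem congruence_chain_length_le {d : ℕ} {g : ℕ → ℕ} (hg : Monotone g) (hinf : ∀ x, x < g x)
    (hsup : ∀ x y, 1 ≤ x → 1 ≤ y → g x * y ≤ g (x * y)) {n ℓ : ℕ}
    (Q : Fin (ℓ + 1) → AddCon (Fin d → ℕ)) (hQ : IsControlledChain g n fun i => graph (Q i)) :
    ℓ ≤ hardyPow g (4 * d) (4 * d * n) := by
  have hmono : Monotone Q :=
    Fin.monotone_iff_le_succ.2 fun i => graph_subset_iff.1 (hQ.ssubset i).subset
  -- For `n = 0` the first witness would be the zero vector, a reflexive pair lying in every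
  -- congruence, so `ℓ = 0`.
  rcases Nat.eq_zero_or_pos n with rfl | hn
  · rcases Nat.eq_zero_or_pos ℓ with rfl | hℓ
    · exact Nat.zero_le _
    · obtain ⟨s, hs, hnorm⟩ := hQ.control ⟨0, hℓ⟩
      obtain rfl : s = 0 := by
        funext i
        exact Nat.le_zero.1 ((Finset.le_sup (f := s) (Finset.mem_univ i)).trans hnorm)
      exact absurd ((Q _).refl 0) hs.2
  · have hex : ∀ i : Fin ℓ, ∃ p ∈ translation (Q i.succ) \ translation (Q i.castSucc),
        maxNorm p ≤ g^[(i : ℕ)] n := fun i => by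
      obtain ⟨s, hs, hnorm⟩ := hQ.control i
      obtain ⟨p, hp, hps⟩ := exists_mem_translation_diff (hmono (Fin.castSucc_le_succ i)) hs
      exact ⟨p, hp, hps.trans hnorm⟩
    choose p hp hnorm using hex
    have hcard : Fintype.card ((Fin d ⊕ Fin d) ⊕ (Fin d ⊕ Fin d)) = 4 * d := by
      simp only [Fintype.card_sum, Fintype.card_fin]
      omega
    rw [← hcard]
    -- For `i < j`, `p i ≤ p j` would put `p j` into `translation (Q i.succ)`, which is contained in
    -- `translation (Q j.castSucc)`.
    refine bad_sequence_length_le hg hinf hsup hn p hnorm fun i j hij hle => (hp j).2 ?_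
    exact (upperClosure _).upper hle
      (translation_mono (hmono (Fin.succ_le_castSucc_iff.2 hij)) (hp i).1)

end CongChain

theorem mainTheorem6 (d : ℕ) :
    (∀ Q : AddCon (Fin d → ℕ), IsUpperSet (CongChain.translation Q)) ∧
    (∀ Q₁ Q₂ : AddCon (Fin d → ℕ), CongChain.graph Q₁ ⊆ CongChain.graph Q₂ →
      CongChain.translation Q₁ ⊆ CongChain.translation Q₂ ∧
      ∀ q ∈ CongChain.graph Q₂ \ CongChain.graph Q₁,
        ∃ p ∈ CongChain.translation Q₂ \ CongChain.translation Q₁,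
          CongChain.maxNorm p ≤ CongChain.maxNorm q) ∧
    (∀ g : ℕ → ℕ, Monotone g → (∀ x, x < g x) →
      (∀ x y, 1 ≤ x → 1 ≤ y → g x * y ≤ g (x * y)) →
      ∀ (n ℓ : ℕ) (Q : Fin (ℓ + 1) → AddCon (Fin d → ℕ)),
        CongChain.IsControlledChain g n (fun i => CongChain.graph (Q i)) →
        ℓ + 1 ≤ 1 + CongChain.hardy g (CongChain.omegaPow (4 * d)) (4 * d * n)) := by
  refine ⟨fun Q => (upperClosure _).upper, fun Q₁ Q₂ h => ?_, ?_⟩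
  · have h' := CongChain.graph_subset_iff.1 h
    exact ⟨CongChain.translation_mono h', fun q hq => CongChain.exists_mem_translation_diff h' hq⟩
  · intro g hg hinf hsup n ℓ Q hQ
    rw [CongChain.hardy_omegaPow, add_comm 1]
    exact Nat.succ_le_succ (CongChain.congruence_chain_length_le hg hinf hsup Q hQ)
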